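/- Let $d\ge 1$, let $\langle\cdot;\cdot\rangle$ and $\|\cdot\|$ be the Euclidean inner product and norm on $\mathbb R^d$, and let $\mathcal S(\mathbb R^d)$ be the space of real-valued Schwartz functions on $\mathbb R^d$. A Lévy measure is a positive Borel measure $\nu$ on $\mathbb R^d$ with $\nu(\{0\})=0$ and $\int_{\mathbb R^d}(1\wedge\|u\|^2)\,\nu(du)<+\infty$. For $c>0$ let $T_c(\nu)(B)=\nu(B/c)$ for all Borel sets $B\subset\mathbb R^d$. For $\alpha\in(0,2)$, a random vector $X$ in $\mathbb R^d$ is called stable with parameter $b\in\mathbb R^d$, stability index $\alpha$ and Lévy measure $\nu$ if it is infinitely divisible with triplet $(b,0,\nu)$, i.e. $\nu$ is a Lévy measure and, for all $\xi\in\mathbb R^d$, $$\mathbb E e^{i\langle \xi;X\rangle}=\exp\left(i\langle b;\xi\rangle+\int_{\mathbb R^d}\left(e^{i\langle\xi;u\rangle}-1-i\langle\xi;u\rangle\mathbf 1_{\{\|u\|\le1\}}\right)\nu(du)\right),$$ and if $\nu(du)=\mathbf 1_{(0,+\infty)}(r)\mathbf 1_{\mathbb S^{d-1}}(x)\frac{dr}{r^{\alpha+1}}\sigma(dx)$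 in polar coordinates $u=rx$, for some finite positive measure $\sigma$ on the unit sphere $\mathbb S^{d-1}$. **Theorem.** Let $X$ be a random vector in $\mathbb R^d$, let $b\in\mathbb R^d$, let $\alpha\in(0,1)$ and let $\nu$ be a Lévy measure on $\mathbb R^d$ such that $\nu=c^{-\alpha}T_c(\nu)$ for all $c>0$. Then $\int_{\|u\|\le1}\|u\|\,\nu(du)<+\infty$, so that $b_0=b-\int_{\|u\|\le 1}u\,\nu(du)$ is well defined, and, for every $f\in\mathcal S(\mathbb R^d)$, all the integrals and expectations in the identity below converge absolutely. Moreover, $$\mathbb E\langle X;\nabla f(X)\rangle=\mathbb E\langle b_0;\nabla f(X)\rangle+\alpha\,\mathbb E\int_{\mathbb R^d}\left(f(X+u)-f(X)\right)\nu(du)\qquad\text{for all } f\in\mathcal S(\mathbb R^d)$$ if and only if $X$ is a stable random vector with parameter $b$, stability index $\alpha$ and Lévy measure $\nu$. -/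

import Mathlib

open MeasureTheory
open scoped SchwartzMap Gradient

namespace SteinStable

/-- A Lévy measure on `ℝᵈ`: a positive Borel measure `ν` with `ν {0} = 0` and
`∫ (1 ∧ ‖u‖²) ν(du) < ∞`. -/
structure IsLevyMeasure {d : ℕ} (ν : Measure (EuclideanSpace ℝ (Fin d))) : Prop where
  measure_zero : ν {0} = 0
  lintegral_lt_top : ∫⁻ u, ENNReal.ofReal (min 1 (‖u‖ ^ 2)) ∂ν < ⊤

/-- The transformation `T_c` of measures, `T_c(ν)(B) = ν(B/c)` (see `dilate_apply`): the image
of `ν` under `u ↦ c u`. -/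
noncomputable def dilate {d : ℕ} (c : ℝ) (ν : Measure (EuclideanSpace ℝ (Fin d))) :
    Measure (EuclideanSpace ℝ (Fin d)) :=
  ν.map (fun u => c • u)

open scoped Pointwise in
theorem dilate_apply {d : ℕ} {c : ℝ} (hc : 0 < c) (ν : Measure (EuclideanSpace ℝ (Fin d)))
    {B : Set (EuclideanSpace ℝ (Fin d))} (hB : MeasurableSet B) :
    dilate c ν B = ν (c⁻¹ • B) := by
  rw [dilate, Measure.map_apply (measurable_const_smul c) hB,
    ← Set.preimage_smul_inv₀ (inv_ne_zero hc.ne') B, inv_inv]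

/-- The Lévy–Khintchine exponent of the triplet `(b, S, ν)` at `ξ`:
`i⟨b,ξ⟩ - ½⟨ξ,Sξ⟩ + ∫ (e^{i⟨ξ,u⟩} - 1 - i⟨ξ,u⟩ 1_{‖u‖ ≤ 1}) ν(du)`. -/
noncomputable def levyExponent {d : ℕ} (b : EuclideanSpace ℝ (Fin d))
    (S : Matrix (Fin d) (Fin d) ℝ) (ν : Measure (EuclideanSpace ℝ (Fin d)))
    (ξ : EuclideanSpace ℝ (Fin d)) : ℂ :=
  Complex.I * (inner ℝ b ξ : ℝ)
    - (1 / 2 : ℂ) * ((dotProduct ξ.ofLp (S.mulVec ξ.ofLp) : ℝ) : ℂ)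
    + ∫ u, (Complex.exp (Complex.I * (inner ℝ ξ u : ℝ)) - 1
        - Complex.I * (((Metric.closedBall (0 : EuclideanSpace ℝ (Fin d)) 1).indicator
            (fun v => (inner ℝ ξ v : ℝ)) u : ℝ) : ℂ)) ∂ν

/-- The law `μ` on `ℝᵈ` is infinitely divisible with generating triplet `(b, S, ν)`. -/
structure IsInfDivWithTriplet {d : ℕ} (μ : Measure (EuclideanSpace ℝ (Fin d)))
    (b : EuclideanSpace ℝ (Fin d)) (S : Matrix (Fin d) (Fin d) ℝ)
    (ν : Measure (EuclideanSpace ℝ (Fin d))) : Prop where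
  isProbabilityMeasure : IsProbabilityMeasure μ
  posSemidef : S.PosSemidef
  isLevyMeasure : IsLevyMeasure ν
  charFun_eq : ∀ ξ, charFun μ ξ = Complex.exp (levyExponent b S ν ξ)

/-- The measure `1_{(0,∞)}(r) 1_{S^{d-1}}(x) r^{-(α+1)} dr σ(dx)` on `ℝᵈ`, in polar coordinates
`u = r x`. -/
noncomputable def polarStableMeasure {d : ℕ} (α : ℝ)
    (σ : Measure (Metric.sphere (0 : EuclideanSpace ℝ (Fin d)) 1)) :
    Measure (EuclideanSpace ℝ (Fin d)) :=
  (σ.prod ((volume.restrict (Set.Ioi (0 : ℝ))).withDensity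
      (fun r => ENNReal.ofReal (r ^ (-(α + 1)))))).map
    (fun p => p.2 • (p.1 : EuclideanSpace ℝ (Fin d)))

/-- The law `μ` on `ℝᵈ` is `α`-stable, `0 < α < 2`, with parameter `b` and Lévy measure `ν`: it is
infinitely divisible with triplet `(b, 0, ν)`, and `ν` has the polar decomposition
`r^{-(α+1)} dr σ(dx)` with a finite positive measure `σ` on the unit sphere. -/
structure IsStableLaw {d : ℕ} (μ : Measure (EuclideanSpace ℝ (Fin d)))
    (b : EuclideanSpace ℝ (Fin d)) (α : ℝ) (ν : Measure (EuclideanSpace ℝ (Fin d))) : Prop where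
  index_pos : 0 < α
  index_lt_two : α < 2
  infDiv : IsInfDivWithTriplet μ b 0 ν
  polar : ∃ σ : Measure (Metric.sphere (0 : EuclideanSpace ℝ (Fin d)) 1),
    IsFiniteMeasure σ ∧ ν = polarStableMeasure α σ

/-- The drift `b₀ = b - ∫_{‖u‖ ≤ 1} u ν(du)`. -/
noncomputable def drift {d : ℕ} (b : EuclideanSpace ℝ (Fin d))
    (ν : Measure (EuclideanSpace ℝ (Fin d))) : EuclideanSpace ℝ (Fin d) :=
  b - ∫ u in Metric.closedBall (0 : EuclideanSpace ℝ (Fin d)) 1, u ∂ν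

end SteinStable

/-! Scaling carries the whole argument. Since `ν` scales with exponent `α`, the part of `ν` in a
cone has tail proportional to `t^(-α)`. This forces the polar form (`exists_eq_polarStableMeasure`),
and with `α < 1` it makes `min 1 ‖u‖` integrable. The compensator can then be moved into the drift,
so the exponent becomes `i⟨b₀,ξ⟩ + ψ(ξ)` with `ψ = jumpExponent ν` and `ψ(tξ) = t^α ψ(ξ)`. Stability
thus amounts to a formula for the characteristic function, and translating by `b₀` reduces it to `φ
= exp ψ` for the law `μ` of `Y = X - b₀`.

Both directions compute the derivative of `t ↦ E g(tY)`, which at `t = 1` is `E⟨Y, ∇g(Y)⟩`. If `φ =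
exp ψ`, Fourier inversion turns `E g(tY)` into an integral of `exp(t^α ψ)`. Its derivative at `1`
brings down `α ψ`, the symbol of the jump operator `g ↦ ∫ (g(· + u) - g) ν(du)` times `α`
(`integral_fderiv_self_eq_of_charFun`).

Conversely, the identity applied to `g(r ·)`, combined with scaling, gives the derivative at every
`r > 0`. Letting `g` approach the character `e^{i⟨·,ξ⟩}`, an eigenfunction of the jump operator,
yields `G' = α t^(α-1) ψ(ξ) G` for `G(t) = φ(tξ)`. With `G(0) = 1` this gives `φ(ξ) = exp ψ(ξ)`
(`charFun_eq_exp_jumpExponent_of_stein`). -/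

namespace SteinStable

/-! ### The radial measure and its tails -/

/-- The radial measure `1_{(0,∞)}(r) r^{-(α+1)} dr`. -/
noncomputable def radialMeasure (α : ℝ) : Measure ℝ :=
  (volume.restrict (Set.Ioi (0 : ℝ))).withDensity (fun r => ENNReal.ofReal (r ^ (-(α + 1))))

instance sigmaFinite_radialMeasure (α : ℝ) : SigmaFinite (radialMeasure α) := by
  unfold radialMeasure; infer_instance

theorem radialMeasure_Ioi {α t : ℝ} (hα : 0 < α) (ht : 0 < t) :
    radialMeasure α (Set.Ioi t) = ENNReal.ofReal (t ^ (-α) / α) := by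
  have hs : Set.Ioi t ⊆ Set.Ioi 0 := Set.Ioi_subset_Ioi ht.le
  rw [radialMeasure, withDensity_apply _ measurableSet_Ioi,
    Measure.restrict_restrict measurableSet_Ioi, Set.inter_eq_self_of_subset_left hs,
    ← ofReal_integral_eq_lintegral_ofReal (integrableOn_Ioi_rpow_of_lt (by linarith) ht)
      (ae_restrict_of_forall_mem measurableSet_Ioi
        fun x hx => Real.rpow_nonneg (ht.le.trans (le_of_lt hx)) _),
    integral_Ioi_rpow_of_lt (by linarith) ht]
  congr 1
  rw [show -(α + 1) + 1 = -α by ring, neg_div_neg_eq]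

theorem radialMeasure_Iic_zero (α : ℝ) : radialMeasure α (Set.Iic 0) = 0 := by
  rw [radialMeasure, withDensity_apply _ measurableSet_Iic,
    Measure.restrict_restrict measurableSet_Iic, Set.Iic_inter_Ioi, Set.Ioc_self,
    Measure.restrict_empty, lintegral_zero_measure]

/-- Near `0` the integrand is `r^(-α)`, integrable because `α < 1`; beyond `1` it is at most
`r^(-(α+1))`, integrable because `α > 0`. -/
theorem lintegral_radialMeasure_min_one_lt_top {α : ℝ} (hα0 : 0 < α) (hα1 : α < 1) :
    ∫⁻ r, ENNReal.ofReal (min 1 |r|) ∂(radialMeasure α) < ⊤ := by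
  have hm : Measurable fun r : ℝ => ENNReal.ofReal (r ^ (-(α + 1))) := by fun_prop
  rw [radialMeasure, lintegral_withDensity_eq_lintegral_mul _ hm (by fun_prop)]
  have hle : ∫⁻ r in Set.Ioi (0 : ℝ), ENNReal.ofReal (r ^ (-(α + 1))) * ENNReal.ofReal (min 1 |r|)
      ≤ (∫⁻ r in Set.Ioc (0 : ℝ) 1, ENNReal.ofReal (r ^ (-α)))
        + ∫⁻ r in Set.Ioi (1 : ℝ), ENNReal.ofReal (r ^ (-(α + 1))) := by
    rw [← Set.Ioc_union_Ioi_eq_Ioi (zero_le_one' ℝ),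
      lintegral_union measurableSet_Ioi (Set.Ioc_disjoint_Ioi le_rfl)]
    refine add_le_add ?_ ?_
    · refine setLIntegral_mono' measurableSet_Ioc fun r hr => ?_
      rw [← ENNReal.ofReal_mul (Real.rpow_nonneg hr.1.le _)]
      refine ENNReal.ofReal_le_ofReal ?_
      calc r ^ (-(α + 1)) * min 1 |r| ≤ r ^ (-(α + 1)) * r :=
            mul_le_mul_of_nonneg_left ((min_le_right _ _).trans_eq (abs_of_pos hr.1))
              (Real.rpow_nonneg hr.1.le _)
        _ = r ^ (-α) := by
            rw [← Real.rpow_add_one hr.1.ne']; congr 1; ring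
    · refine setLIntegral_mono' measurableSet_Ioi fun r hr => ?_
      exact mul_le_of_le_one_right' (ENNReal.ofReal_le_one.2 (min_le_left _ _))
  refine hle.trans_lt (ENNReal.add_lt_top.2 ⟨?_, ?_⟩)
  · have h : IntegrableOn (fun r : ℝ => r ^ (-α)) (Set.Ioc 0 1) :=
      (intervalIntegrable_iff_integrableOn_Ioc_of_le zero_le_one).1
        (intervalIntegral.intervalIntegrable_rpow' (by linarith))
    exact h.lintegral_lt_top
  · exact (integrableOn_Ioi_rpow_of_lt (by linarith) one_pos).lintegral_lt_top

/-! ### Polar decomposition of a scale-invariant Lévy measure -/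

section Polar

variable {d : ℕ} {ν : Measure (EuclideanSpace ℝ (Fin d))} {α : ℝ}

theorem IsLevyMeasure.measure_lt_norm_lt_top (hν : IsLevyMeasure ν) {t : ℝ} (ht : 0 < t) :
    ν {u | t < ‖u‖} < ⊤ := by
  have hε : 0 < min 1 (t ^ 2) := lt_min one_pos (pow_pos ht 2)
  have h := meas_ge_le_lintegral_div (μ := ν)
    (f := fun u => ENNReal.ofReal (min 1 (‖u‖ ^ 2))) (by fun_prop)
    (ε := ENNReal.ofReal (min 1 (t ^ 2))) (ENNReal.ofReal_pos.2 hε).ne' ENNReal.ofReal_ne_top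
  refine (measure_mono fun u hu => ?_).trans_lt
    (h.trans_lt (ENNReal.div_lt_top hν.lintegral_lt_top.ne (ENNReal.ofReal_pos.2 hε).ne'))
  exact ENNReal.ofReal_le_ofReal
    (min_le_min_left _ (pow_le_pow_left₀ ht.le (le_of_lt hu) 2))

open Classical in
/-- The direction `u / ‖u‖` of a vector, with value `e` at `0`. -/
noncomputable def direction (e : Metric.sphere (0 : EuclideanSpace ℝ (Fin d)) 1)
    (u : EuclideanSpace ℝ (Fin d)) : Metric.sphere (0 : EuclideanSpace ℝ (Fin d)) 1 :=
  ⟨if u = 0 then e else ‖u‖⁻¹ • u, by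
    split_ifs with h
    · exact e.2
    · simp [norm_smul, h]⟩

theorem measurable_direction (e : Metric.sphere (0 : EuclideanSpace ℝ (Fin d)) 1) :
    Measurable (direction e) := by
  refine Measurable.subtype_mk (Measurable.ite ?_ measurable_const (by fun_prop))
  exact measurableSet_singleton 0

theorem direction_smul (e : Metric.sphere (0 : EuclideanSpace ℝ (Fin d)) 1) {t : ℝ} (ht : 0 < t)
    (u : EuclideanSpace ℝ (Fin d)) : direction e (t • u) = direction e u := by
  apply Subtype.ext
  simp only [direction, smul_eq_zero, ht.ne', false_or]
  split_ifs with h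
  · rfl
  · rw [norm_smul, smul_smul, Real.norm_of_nonneg ht.le]
    congr 1
    field_simp

theorem norm_smul_direction (e : Metric.sphere (0 : EuclideanSpace ℝ (Fin d)) 1)
    (u : EuclideanSpace ℝ (Fin d)) :
    ‖u‖ • (direction e u : EuclideanSpace ℝ (Fin d)) = u := by
  by_cases h : u = 0
  · simp [h]
  · simp [direction, h]

theorem measure_direction_inter_lt_norm
    (hscale : ∀ c : ℝ, 0 < c → ν = ENNReal.ofReal (c ^ (-α)) • dilate c ν)
    (e : Metric.sphere (0 : EuclideanSpace ℝ (Fin d)) 1)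
    {A : Set (Metric.sphere (0 : EuclideanSpace ℝ (Fin d)) 1)} (hA : MeasurableSet A)
    {t : ℝ} (ht : 0 < t) :
    ν (direction e ⁻¹' A ∩ {u | t < ‖u‖}) =
      ENNReal.ofReal (t ^ (-α)) * ν (direction e ⁻¹' A ∩ {u | 1 < ‖u‖}) := by
  have hm : MeasurableSet (direction e ⁻¹' A ∩ {u | t < ‖u‖}) :=
    (measurable_direction e hA).inter (measurableSet_lt measurable_const measurable_norm)
  conv_lhs => rw [hscale t ht]
  rw [Measure.smul_apply, smul_eq_mul, dilate, Measure.map_apply (measurable_const_smul t) hm]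
  congr 2
  ext u
  simp [direction_smul e ht, norm_smul, abs_of_pos ht, ht]

/-- Both sides have the same tails on `(t, ∞)`, multiples of `t^(-α)`. These tails are finite since
`ν` is a Lévy measure, so π-system uniqueness applies on each `(1/(n+1), ∞)`. These sets exhaust
`(0, ∞)`, and neither side charges the complement. -/
theorem map_norm_restrict_direction (hν : IsLevyMeasure ν) (hα : 0 < α)
    (hscale : ∀ c : ℝ, 0 < c → ν = ENNReal.ofReal (c ^ (-α)) • dilate c ν)
    (e : Metric.sphere (0 : EuclideanSpace ℝ (Fin d)) 1)
    {A : Set (Metric.sphere (0 : EuclideanSpace ℝ (Fin d)) 1)} (hA : MeasurableSet A) :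
    (ν.restrict (direction e ⁻¹' A)).map norm =
      (ENNReal.ofReal α * ν (direction e ⁻¹' A ∩ {u | 1 < ‖u‖})) • radialMeasure α := by
  set ρ := (ν.restrict (direction e ⁻¹' A)).map norm with hρ
  set m := ν (direction e ⁻¹' A ∩ {u | 1 < ‖u‖}) with hm
  have hρ_apply : ∀ {s : Set ℝ}, MeasurableSet s →
      ρ s = ν (direction e ⁻¹' A ∩ {u | ‖u‖ ∈ s}) := fun {s} hs => by
    rw [hρ, Measure.map_apply measurable_norm hs, Measure.restrict_apply (measurable_norm hs),
      Set.inter_comm]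
    rfl
  have hIoi : ∀ t : ℝ, 0 < t →
      ρ (Set.Ioi t) = ((ENNReal.ofReal α * m) • radialMeasure α) (Set.Ioi t) := fun t ht => by
    rw [hρ_apply measurableSet_Ioi, Measure.smul_apply, radialMeasure_Ioi hα ht, smul_eq_mul]
    refine (measure_direction_inter_lt_norm hscale e hA ht).trans ?_
    rw [mul_right_comm, ← ENNReal.ofReal_mul hα.le, mul_div_cancel₀ _ hα.ne']
  have hfin : ∀ t : ℝ, 0 < t → ρ (Set.Ioi t) < ⊤ := fun t ht => by
    rw [hρ_apply measurableSet_Ioi]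
    exact (measure_mono Set.inter_subset_right).trans_lt (hν.measure_lt_norm_lt_top ht)
  have hU : (⋃ n : ℕ, Set.Ioi (1 / ((n : ℝ) + 1))) = Set.Ioi 0 := by
    ext x
    simp only [Set.mem_iUnion, Set.mem_Ioi]
    exact ⟨fun ⟨n, hn⟩ => Nat.one_div_pos_of_nat.trans hn, fun hx => exists_nat_one_div_lt hx⟩
  have hrestrict : ρ.restrict (Set.Ioi 0) =
      ((ENNReal.ofReal α * m) • radialMeasure α).restrict (Set.Ioi 0) := by
    rw [← hU, Measure.restrict_iUnion_congr]
    intro n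
    have hn : (0 : ℝ) < 1 / ((n : ℝ) + 1) := Nat.one_div_pos_of_nat
    have : IsFiniteMeasure (ρ.restrict (Set.Ioi (1 / ((n : ℝ) + 1)))) :=
      ⟨by rw [Measure.restrict_apply_univ]; exact hfin _ hn⟩
    refine ext_of_generate_finite _ (BorelSpace.measurable_eq.trans (borel_eq_generateFrom_Ioi ℝ))
      isPiSystem_Ioi ?_ ?_
    · rintro _ ⟨a, rfl⟩
      rw [Measure.restrict_apply measurableSet_Ioi, Measure.restrict_apply measurableSet_Ioi,
        Set.Ioi_inter_Ioi]
      exact hIoi _ (lt_max_of_lt_right hn)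
    · rw [Measure.restrict_apply_univ, Measure.restrict_apply_univ]
      exact hIoi _ hn
  have hself : ∀ κ : Measure ℝ, κ (Set.Iic 0) = 0 → κ.restrict (Set.Ioi 0) = κ := fun κ hκ =>
    Measure.restrict_eq_self_of_ae_mem <| by
      rw [ae_iff]; simpa [Set.Iic] using hκ
  rw [← hself ρ, hrestrict, hself]
  · rw [Measure.smul_apply, radialMeasure_Iic_zero, smul_zero]
  · rw [hρ_apply measurableSet_Iic]
    refine measure_mono_null (fun u hu => ?_) hν.measure_zero
    simpa using hu.2

theorem exists_eq_polarStableMeasure (hd : 1 ≤ d) (hν : IsLevyMeasure ν) (hα : 0 < α)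
    (hscale : ∀ c : ℝ, 0 < c → ν = ENNReal.ofReal (c ^ (-α)) • dilate c ν) :
    ∃ σ : Measure (Metric.sphere (0 : EuclideanSpace ℝ (Fin d)) 1),
      IsFiniteMeasure σ ∧ ν = polarStableMeasure α σ := by
  have : Nonempty (Fin d) := ⟨⟨0, hd⟩⟩
  obtain ⟨e, he⟩ := NormedSpace.sphere_nonempty (E := EuclideanSpace ℝ (Fin d)) (x := 0)
    (r := 1) |>.2 zero_le_one
  lift e to Metric.sphere (0 : EuclideanSpace ℝ (Fin d)) 1 using he
  have hdir := measurable_direction e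
  have hlt : MeasurableSet {u : EuclideanSpace ℝ (Fin d) | 1 < ‖u‖} :=
    measurableSet_lt measurable_const measurable_norm
  -- The factor `α` compensates the radial mass `1/α` of `(1, ∞)`.
  set σ := ENNReal.ofReal α • (ν.restrict {u | 1 < ‖u‖}).map (direction e) with hσ
  have hσ_apply : ∀ {A}, MeasurableSet A →
      σ A = ENNReal.ofReal α * ν (direction e ⁻¹' A ∩ {u | 1 < ‖u‖}) := fun {A} hA => by
    rw [hσ, Measure.smul_apply, Measure.map_apply hdir hA, Measure.restrict_apply (hdir hA),
      smul_eq_mul]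
  have hfin : IsFiniteMeasure σ := ⟨by
    rw [hσ_apply MeasurableSet.univ]
    exact ENNReal.mul_lt_top ENNReal.ofReal_lt_top
      ((measure_mono Set.inter_subset_right).trans_lt (hν.measure_lt_norm_lt_top one_pos))⟩
  refine ⟨σ, hfin, ?_⟩
  have hprod : σ.prod (radialMeasure α) = ν.map (fun u => (direction e u, ‖u‖)) := by
    refine Measure.prod_eq fun A B hA hB => ?_
    rw [Measure.map_apply (hdir.prodMk measurable_norm) (hA.prod hB), hσ_apply hA]
    have h := congrArg (· B) (map_norm_restrict_direction hν hα hscale e hA)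
    simp only [Measure.smul_apply, smul_eq_mul] at h
    rw [← h, Measure.map_apply measurable_norm hB, Measure.restrict_apply (measurable_norm hB),
      Set.inter_comm]
    rfl
  rw [polarStableMeasure]
  change ν = (σ.prod (radialMeasure α)).map _
  rw [hprod, Measure.map_map (by fun_prop) (hdir.prodMk measurable_norm)]
  simp [Function.comp_def, norm_smul_direction]

theorem integrable_min_one_norm (hd : 1 ≤ d) (hν : IsLevyMeasure ν) (hα0 : 0 < α) (hα1 : α < 1)
    (hscale : ∀ c : ℝ, 0 < c → ν = ENNReal.ofReal (c ^ (-α)) • dilate c ν) :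
    Integrable (fun u => min 1 ‖u‖) ν := by
  obtain ⟨σ, hσ, h⟩ := exists_eq_polarStableMeasure hd hν hα0 hscale
  refine ⟨by fun_prop, ?_⟩
  rw [hasFiniteIntegral_iff_ofReal (Filter.Eventually.of_forall fun u => by positivity), h,
    polarStableMeasure]
  change ∫⁻ u, ENNReal.ofReal (min 1 ‖u‖) ∂((σ.prod (radialMeasure α)).map _) < ⊤
  rw [lintegral_map (by fun_prop) (by fun_prop), lintegral_prod _ (by fun_prop)]
  simp only [norm_smul, norm_eq_of_mem_sphere, mul_one, Real.norm_eq_abs, lintegral_const]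
  exact ENNReal.mul_lt_top (lintegral_radialMeasure_min_one_lt_top hα0 hα1) (measure_lt_top _ _)

theorem IsLevyMeasure.sigmaFinite (hν : IsLevyMeasure ν) : SigmaFinite ν := by
  -- The sets `{1/(n+1) < ‖u‖}` miss the origin; adjoining the null set `{0}` makes them cover the
  -- space.
  refine ⟨⟨⟨fun n => {u | 1 / ((n : ℝ) + 1) < ‖u‖} ∪ {0}, fun _ => trivial, fun n => ?_, ?_⟩⟩⟩
  · refine (measure_union_le _ _).trans_lt (ENNReal.add_lt_top.2 ⟨?_, ?_⟩)
    · exact hν.measure_lt_norm_lt_top Nat.one_div_pos_of_nat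
    · simp [hν.measure_zero]
  · refine Set.eq_univ_of_forall fun u => ?_
    by_cases hu : u = 0
    · simp [hu]
    · obtain ⟨n, hn⟩ := exists_nat_one_div_lt (norm_pos_iff.2 hu)
      exact Set.mem_iUnion.2 ⟨n, Or.inl hn⟩

end Polar

/-! ### The jump exponent and the jump operator -/

section Increments

variable {d : ℕ} {ν : Measure (EuclideanSpace ℝ (Fin d))} {α : ℝ}

/-- The exponent `∫ (e^{i⟨ξ,u⟩} - 1) ν(du)` of the uncompensated jump part. -/
noncomputable def jumpExponent (ν : Measure (EuclideanSpace ℝ (Fin d)))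
    (ξ : EuclideanSpace ℝ (Fin d)) : ℂ :=
  ∫ u, (Complex.exp (Complex.I * (inner ℝ ξ u : ℝ)) - 1) ∂ν

theorem integral_comp_smul_of_scale {F : Type*} [NormedAddCommGroup F] [NormedSpace ℝ F]
    (hscale : ∀ c : ℝ, 0 < c → ν = ENNReal.ofReal (c ^ (-α)) • dilate c ν)
    {c : ℝ} (hc : 0 < c) (h : EuclideanSpace ℝ (Fin d) → F) :
    ∫ u, h (c • u) ∂ν = c ^ α • ∫ u, h u ∂ν := by
  -- Change of variables along an embedding requires no measurability of `h`.
  have hemb : MeasurableEmbedding fun u : EuclideanSpace ℝ (Fin d) => c • u :=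
    (Homeomorph.smulOfNeZero c hc.ne').measurableEmbedding
  conv_rhs => rw [hscale c hc]
  rw [integral_smul_measure, dilate, hemb.integral_map,
    ENNReal.toReal_ofReal (Real.rpow_nonneg hc.le _), smul_smul, ← Real.rpow_add hc,
    add_neg_cancel, Real.rpow_zero, one_smul]

/-- The bound `2` serves for large `u` and `‖ξ‖ * ‖u‖` for small `u`. Growth is only linear in `ξ`,
so one moment of a Fourier weight suffices for domination later. -/
theorem norm_exp_inner_sub_one_le (ξ u : EuclideanSpace ℝ (Fin d)) :
    ‖Complex.exp (Complex.I * (inner ℝ ξ u : ℝ)) - 1‖ ≤ 2 * (1 + ‖ξ‖) * min 1 ‖u‖ := by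
  rcases le_total 1 ‖u‖ with hu | hu
  · rw [min_eq_left hu]
    have h : ‖Complex.exp (Complex.I * (inner ℝ ξ u : ℝ))‖ = 1 :=
      Complex.norm_exp_I_mul_ofReal _
    refine (norm_sub_le _ _).trans ?_
    rw [h, norm_one]
    nlinarith [norm_nonneg ξ]
  · rw [min_eq_right hu]
    refine Real.norm_exp_I_mul_ofReal_sub_one_le.trans ((norm_inner_le_norm ξ u).trans ?_)
    nlinarith [norm_nonneg ξ, norm_nonneg u, mul_nonneg (norm_nonneg ξ) (norm_nonneg u)]

theorem integrable_exp_inner_sub_one (hint : Integrable (fun u => min 1 ‖u‖) ν)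
    (ξ : EuclideanSpace ℝ (Fin d)) :
    Integrable (fun u => Complex.exp (Complex.I * (inner ℝ ξ u : ℝ)) - 1) ν :=
  (hint.const_mul (2 * (1 + ‖ξ‖))).mono'
    (Continuous.aestronglyMeasurable (by fun_prop))
    (Filter.Eventually.of_forall fun u => norm_exp_inner_sub_one_le ξ u)

theorem norm_jumpExponent_le (hint : Integrable (fun u => min 1 ‖u‖) ν)
    (ξ : EuclideanSpace ℝ (Fin d)) :
    ‖jumpExponent ν ξ‖ ≤ 2 * (1 + ‖ξ‖) * ∫ u, min 1 ‖u‖ ∂ν := by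
  rw [← integral_const_mul]
  exact norm_integral_le_of_norm_le (hint.const_mul _)
    (Filter.Eventually.of_forall fun u => norm_exp_inner_sub_one_le ξ u)

theorem jumpExponent_smul
    (hscale : ∀ c : ℝ, 0 < c → ν = ENNReal.ofReal (c ^ (-α)) • dilate c ν)
    {t : ℝ} (ht : 0 < t) (ξ : EuclideanSpace ℝ (Fin d)) :
    jumpExponent ν (t • ξ) = (t ^ α : ℝ) * jumpExponent ν ξ := by
  have h := integral_comp_smul_of_scale hscale ht
    (fun u => Complex.exp (Complex.I * (inner ℝ ξ u : ℝ)) - 1)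
  simp only [jumpExponent, real_inner_smul_left]
  simpa only [real_inner_smul_right, Complex.real_smul] using h

theorem continuous_jumpExponent (hint : Integrable (fun u => min 1 ‖u‖) ν) :
    Continuous (jumpExponent ν) := by
  refine continuous_iff_continuousAt.2 fun ξ₀ => ?_
  refine continuousAt_of_dominated (bound := fun u => 2 * (1 + (‖ξ₀‖ + 1)) * min 1 ‖u‖)
    (Filter.Eventually.of_forall fun ξ => Continuous.aestronglyMeasurable (by fun_prop)) ?_
    (hint.const_mul _) (Filter.Eventually.of_forall fun u => by fun_prop)
  filter_upwards [Metric.ball_mem_nhds ξ₀ one_pos] with ξ hξ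
  refine Filter.Eventually.of_forall fun u => (norm_exp_inner_sub_one_le ξ u).trans ?_
  have h1 : ‖ξ‖ ≤ ‖ξ₀‖ + 1 := by
    have := norm_le_norm_add_norm_sub' ξ ξ₀
    rw [mem_ball_iff_norm] at hξ
    linarith
  gcongr

theorem integrableOn_id_closedBall (hint : Integrable (fun u => min 1 ‖u‖) ν) :
    IntegrableOn (fun u : EuclideanSpace ℝ (Fin d) => u) (Metric.closedBall 0 1) ν := by
  refine hint.integrableOn.mono' (by fun_prop) ?_
  refine ae_restrict_of_forall_mem measurableSet_closedBall fun u hu => ?_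
  rw [min_eq_right (mem_closedBall_zero_iff.1 hu)]

/-- Integrability of `min 1 ‖u‖` allows the compensator to be integrated on its own; it gives the
linear term that turns `b` into `drift b ν`. -/
theorem levyExponent_zero_eq (hint : Integrable (fun u => min 1 ‖u‖) ν)
    (b ξ : EuclideanSpace ℝ (Fin d)) :
    levyExponent b 0 ν ξ = Complex.I * (inner ℝ (drift b ν) ξ : ℝ) + jumpExponent ν ξ := by
  have hball := integrableOn_id_closedBall hint
  have hind : Integrable ((Metric.closedBall (0 : EuclideanSpace ℝ (Fin d)) 1).indicator
      (fun v => (inner ℝ ξ v : ℝ))) ν :=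
    IntegrableOn.integrable_indicator (hball.const_inner ξ) measurableSet_closedBall
  have hval : ∫ u, (Metric.closedBall (0 : EuclideanSpace ℝ (Fin d)) 1).indicator
      (fun v => (inner ℝ ξ v : ℝ)) u ∂ν =
      inner ℝ ξ (∫ u in Metric.closedBall (0 : EuclideanSpace ℝ (Fin d)) 1, u ∂ν) := by
    rw [integral_indicator measurableSet_closedBall, integral_inner hball]
  have hindC : Integrable (fun u => Complex.I *
      (((Metric.closedBall (0 : EuclideanSpace ℝ (Fin d)) 1).indicator
        (fun v => (inner ℝ ξ v : ℝ)) u : ℝ) : ℂ)) ν := hind.ofReal.const_mul Complex.I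
  rw [levyExponent, integral_sub (integrable_exp_inner_sub_one hint ξ) hindC, integral_const_mul, integral_complex_ofReal, hval, drift,
    inner_sub_left, real_inner_comm ξ (∫ u in _, u ∂ν), jumpExponent]
  simp
  ring

theorem norm_increment_le {F : Type*} [NormedAddCommGroup F]
    {f : EuclideanSpace ℝ (Fin d) → F} {C L : ℝ} (hC : ∀ x, ‖f x‖ ≤ C) (hL : 0 ≤ L)
    (hlip : ∀ x y, ‖f x - f y‖ ≤ L * ‖x - y‖) (x u : EuclideanSpace ℝ (Fin d)) :
    ‖f (x + u) - f x‖ ≤ (2 * C + L) * min 1 ‖u‖ := by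
  have hC0 : 0 ≤ C := (norm_nonneg _).trans (hC x)
  rcases le_total 1 ‖u‖ with hu | hu
  · rw [min_eq_left hu]
    linarith [norm_sub_le (f (x + u)) (f x), hC (x + u), hC x]
  · rw [min_eq_right hu]
    have := hlip (x + u) x
    rw [add_sub_cancel_left] at this
    nlinarith [mul_nonneg hC0 (norm_nonneg u)]

theorem integrable_increment {F : Type*} [NormedAddCommGroup F]
    (hint : Integrable (fun u => min 1 ‖u‖) ν)
    {f : EuclideanSpace ℝ (Fin d) → F} {C L : ℝ} (hf : Continuous f) (hC : ∀ x, ‖f x‖ ≤ C)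
    (hL : 0 ≤ L) (hlip : ∀ x y, ‖f x - f y‖ ≤ L * ‖x - y‖) (x : EuclideanSpace ℝ (Fin d)) :
    Integrable (fun u => f (x + u) - f x) ν :=
  (hint.const_mul (2 * C + L)).mono' (Continuous.aestronglyMeasurable (by fun_prop))
    (Filter.Eventually.of_forall fun u => norm_increment_le hC hL hlip x u)

theorem norm_integral_increment_le {F : Type*} [NormedAddCommGroup F] [NormedSpace ℝ F]
    (hint : Integrable (fun u => min 1 ‖u‖) ν)
    {f : EuclideanSpace ℝ (Fin d) → F} {C L : ℝ} (hC : ∀ x, ‖f x‖ ≤ C)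
    (hL : 0 ≤ L) (hlip : ∀ x y, ‖f x - f y‖ ≤ L * ‖x - y‖) (x : EuclideanSpace ℝ (Fin d)) :
    ‖∫ u, (f (x + u) - f x) ∂ν‖ ≤ (2 * C + L) * ∫ u, min 1 ‖u‖ ∂ν := by
  rw [← integral_const_mul]
  exact norm_integral_le_of_norm_le (hint.const_mul _)
    (Filter.Eventually.of_forall fun u => norm_increment_le hC hL hlip x u)

theorem continuous_integral_increment {F : Type*} [NormedAddCommGroup F] [NormedSpace ℝ F]
    (hint : Integrable (fun u => min 1 ‖u‖) ν)
    {f : EuclideanSpace ℝ (Fin d) → F} {C L : ℝ} (hf : Continuous f) (hC : ∀ x, ‖f x‖ ≤ C)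
    (hL : 0 ≤ L) (hlip : ∀ x y, ‖f x - f y‖ ≤ L * ‖x - y‖) :
    Continuous fun x => ∫ u, (f (x + u) - f x) ∂ν :=
  continuous_of_dominated (bound := fun u => (2 * C + L) * min 1 ‖u‖)
    (fun x => Continuous.aestronglyMeasurable (by fun_prop))
    (fun x => Filter.Eventually.of_forall fun u => norm_increment_le hC hL hlip x u)
    (hint.const_mul _) (Filter.Eventually.of_forall fun u => by fun_prop)

end Increments

/-! ### Bounds for Schwartz functions and absolute convergence -/

section Schwartz

variable {d : ℕ} {ν : Measure (EuclideanSpace ℝ (Fin d))}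
  {F : Type*} [NormedAddCommGroup F] [NormedSpace ℝ F]

/-- The last bound, from the seminorm of index `(1, 1)`, is what dispenses with any moment
assumption on the law: the decay of the derivative absorbs the factor `x`. -/
theorem exists_schwartz_bounds (f : 𝓢(EuclideanSpace ℝ (Fin d), F)) :
    ∃ C L : ℝ, 0 ≤ C ∧ 0 ≤ L ∧ (∀ x, ‖f x‖ ≤ C) ∧ (∀ x y, ‖f x - f y‖ ≤ L * ‖x - y‖) ∧
      (∀ x, ‖fderiv ℝ f x‖ ≤ L) ∧ ∀ x, ‖fderiv ℝ f x x‖ ≤ L := by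
  have h0 : ∀ x, ‖fderiv ℝ f x‖ ≤ SchwartzMap.seminorm ℝ 0 1 f := fun x => by
    simpa [norm_iteratedFDeriv_one] using f.le_seminorm ℝ 0 1 x
  have h1 : ∀ x, ‖fderiv ℝ f x x‖ ≤ SchwartzMap.seminorm ℝ 1 1 f := fun x => by
    have := f.le_seminorm ℝ 1 1 x
    rw [pow_one, norm_iteratedFDeriv_one, mul_comm] at this
    exact ((fderiv ℝ f x).le_opNorm x).trans this
  refine ⟨SchwartzMap.seminorm ℝ 0 0 f,
    max (SchwartzMap.seminorm ℝ 0 1 f) (SchwartzMap.seminorm ℝ 1 1 f), apply_nonneg _ _,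
    le_max_of_le_left (apply_nonneg _ _), f.norm_le_seminorm ℝ, fun x y => ?_,
    fun x => (h0 x).trans (le_max_left _ _), fun x => (h1 x).trans (le_max_right _ _)⟩
  exact convex_univ.norm_image_sub_le_of_norm_fderiv_le (𝕜 := ℝ)
    (fun z _ => f.differentiableAt) (fun z _ => (h0 z).trans (le_max_left _ _))
    (Set.mem_univ y) (Set.mem_univ x)

theorem inner_gradient_eq_fderiv (f : EuclideanSpace ℝ (Fin d) → ℝ)
    (x v : EuclideanSpace ℝ (Fin d)) : inner ℝ v (∇ f x) = fderiv ℝ f x v := by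
  rw [← toDual_gradient, InnerProductSpace.toDual_apply_apply, real_inner_comm]

theorem continuous_fderiv_schwartz (f : 𝓢(EuclideanSpace ℝ (Fin d), F)) :
    Continuous (fderiv ℝ f) :=
  (f.smooth 1).continuous_fderiv one_ne_zero

theorem integrable_terms (hint : Integrable (fun u => min 1 ‖u‖) ν)
    (μ : Measure (EuclideanSpace ℝ (Fin d))) [IsFiniteMeasure μ]
    (f : 𝓢(EuclideanSpace ℝ (Fin d), F)) (v : EuclideanSpace ℝ (Fin d)) :
    Integrable (fun x => fderiv ℝ f x x) μ ∧ Integrable (fun x => fderiv ℝ f x v) μ ∧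
      (∀ x, Integrable (fun u => f (x + u) - f x) ν) ∧
      Integrable (fun x => ∫ u, (f (x + u) - f x) ∂ν) μ := by
  obtain ⟨C, L, hC0, hL0, hC, hlip, hL, hL1⟩ := exists_schwartz_bounds f
  have hcd := continuous_fderiv_schwartz f
  refine ⟨?_, ?_, integrable_increment hint f.continuous hC hL0 hlip, ?_⟩
  · exact .of_bound (hcd.clm_apply continuous_id).aestronglyMeasurable L
      (Filter.Eventually.of_forall hL1)
  · exact .of_bound (hcd.clm_apply continuous_const).aestronglyMeasurable (L * ‖v‖)
      (Filter.Eventually.of_forall fun x => (fderiv ℝ f x).le_of_opNorm_le (hL x) v)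
  · exact .of_bound (continuous_integral_increment hint f.continuous hC hL0 hlip
      ).aestronglyMeasurable _
      (Filter.Eventually.of_forall (norm_integral_increment_le hint hC hL0 hlip))

end Schwartz

/-! ### The jump operator on the Fourier side -/

section FourierRepresentation

variable {d : ℕ} {ν μ κ : Measure (EuclideanSpace ℝ (Fin d))} {α : ℝ}
  {g w : EuclideanSpace ℝ (Fin d) → ℂ}

theorem integral_integral_exp_inner_mul [SFinite κ] [IsFiniteMeasure μ] (hw : Integrable w κ)
    (t : ℝ) :
    ∫ y, ∫ ξ, Complex.exp ((inner ℝ (t • y) ξ : ℝ) * Complex.I) * w ξ ∂κ ∂μ =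
      ∫ ξ, charFun μ (t • ξ) * w ξ ∂κ := by
  rw [integral_integral_swap]
  · refine integral_congr_ae (Filter.Eventually.of_forall fun ξ => ?_)
    simp only [charFun_apply, real_inner_smul_left, real_inner_smul_right]
    rw [integral_mul_const]
  · refine (hw.norm.comp_snd μ).mono' ?_ (Filter.Eventually.of_forall fun p => ?_)
    · exact (Continuous.aestronglyMeasurable (by fun_prop)).mul hw.aestronglyMeasurable.comp_snd
    · simp only [Function.uncurry, norm_mul, Complex.norm_exp_ofReal_mul_I, one_mul, le_refl]

theorem integrable_mul_of_norm_le [SFinite κ] (hw : Integrable w κ)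
    (hw1 : Integrable (fun ξ => ‖ξ‖ * ‖w ξ‖) κ) (M : ℝ) :
    Integrable (fun ξ => M * (1 + ‖ξ‖) * ‖w ξ‖) κ := by
  refine ((hw.norm.add hw1).const_mul M).congr (Filter.Eventually.of_forall fun ξ => ?_)
  simp only [Pi.add_apply]
  ring

/-- The jump operator is a Fourier multiplier with symbol `jumpExponent ν`. Fubini is justified by
the product bound `min 1 ‖u‖ * (2 * (1 + ‖ξ‖) * ‖w ξ‖)`. -/
theorem integral_increment_eq [SFinite κ] [SFinite ν]
    (hint : Integrable (fun u => min 1 ‖u‖) ν) (hw : Integrable w κ)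
    (hw1 : Integrable (fun ξ => ‖ξ‖ * ‖w ξ‖) κ)
    (hg : ∀ x, g x = ∫ ξ, Complex.exp ((inner ℝ x ξ : ℝ) * Complex.I) * w ξ ∂κ)
    (y : EuclideanSpace ℝ (Fin d)) :
    ∫ u, (g (y + u) - g y) ∂ν =
      ∫ ξ, Complex.exp ((inner ℝ y ξ : ℝ) * Complex.I) * (jumpExponent ν ξ * w ξ) ∂κ := by
  have hi : ∀ x : EuclideanSpace ℝ (Fin d), Integrable
      (fun ξ => Complex.exp ((inner ℝ x ξ : ℝ) * Complex.I) * w ξ) κ := fun x =>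
    hw.norm.mono' ((Continuous.aestronglyMeasurable (by fun_prop)).mul hw.aestronglyMeasurable)
      (Filter.Eventually.of_forall fun ξ => by
        simp only [norm_mul, Complex.norm_exp_ofReal_mul_I, one_mul, le_refl])
  have hdiff : ∀ u, g (y + u) - g y = ∫ ξ, Complex.exp ((inner ℝ y ξ : ℝ) * Complex.I) *
      ((Complex.exp (Complex.I * (inner ℝ ξ u : ℝ)) - 1) * w ξ) ∂κ := fun u => by
    rw [hg, hg, ← integral_sub (hi _) (hi _)]
    refine integral_congr_ae (Filter.Eventually.of_forall fun ξ => ?_)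
    simp only [inner_add_left, real_inner_comm u ξ, Complex.ofReal_add, add_mul, Complex.exp_add,
      mul_comm Complex.I]
    ring
  simp only [hdiff]
  rw [integral_integral_swap]
  · refine integral_congr_ae (Filter.Eventually.of_forall fun ξ => ?_)
    simp only [jumpExponent]
    rw [integral_const_mul, integral_mul_const]
  · have hb := hint.mul_prod (integrable_mul_of_norm_le hw hw1 2)
    refine hb.mono' ?_ (Filter.Eventually.of_forall fun p => ?_)
    · exact (Continuous.aestronglyMeasurable (by fun_prop)).mul
        ((Continuous.aestronglyMeasurable (by fun_prop)).mul hw.aestronglyMeasurable.comp_snd)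
    · simp only [Function.uncurry, norm_mul, Complex.norm_exp_ofReal_mul_I, one_mul]
      calc _ ≤ 2 * (1 + ‖p.2‖) * min 1 ‖p.1‖ * ‖w p.2‖ := by
            gcongr; exact norm_exp_inner_sub_one_le _ _
        _ = _ := by ring

theorem integral_integral_increment_eq [SFinite κ] [SFinite ν] [IsFiniteMeasure μ]
    (hint : Integrable (fun u => min 1 ‖u‖) ν) (hw : Integrable w κ)
    (hw1 : Integrable (fun ξ => ‖ξ‖ * ‖w ξ‖) κ)
    (hg : ∀ x, g x = ∫ ξ, Complex.exp ((inner ℝ x ξ : ℝ) * Complex.I) * w ξ ∂κ) :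
    ∫ y, ∫ u, (g (y + u) - g y) ∂ν ∂μ = ∫ ξ, charFun μ ξ * (jumpExponent ν ξ * w ξ) ∂κ := by
  have hψw : Integrable (fun ξ => jumpExponent ν ξ * w ξ) κ := by
    refine (integrable_mul_of_norm_le hw hw1 (2 * ∫ u, min 1 ‖u‖ ∂ν)).mono'
      ((continuous_jumpExponent hint).aestronglyMeasurable.mul hw.aestronglyMeasurable)
      (Filter.Eventually.of_forall fun ξ => ?_)
    rw [norm_mul]
    refine mul_le_mul_of_nonneg_right ((norm_jumpExponent_le hint ξ).trans_eq ?_) (norm_nonneg _)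
    ring
  simp only [integral_increment_eq hint hw hw1 hg]
  simpa only [one_smul] using integral_integral_exp_inner_mul (μ := μ) hψw 1

/-- By homogeneity the integrand is `exp(t^α ψ) w`, differentiated under the integral near `t = 1`.
-/
theorem hasDerivAt_integral_exp_jumpExponent [SFinite κ] [IsProbabilityMeasure μ]
    (hα : 0 < α) (hα1 : α < 1) (hint : Integrable (fun u => min 1 ‖u‖) ν)
    (hscale : ∀ c : ℝ, 0 < c → ν = ENNReal.ofReal (c ^ (-α)) • dilate c ν)
    (hμ : ∀ ξ, charFun μ ξ = Complex.exp (jumpExponent ν ξ)) (hw : Integrable w κ)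
    (hw1 : Integrable (fun ξ => ‖ξ‖ * ‖w ξ‖) κ) :
    HasDerivAt (fun t : ℝ => ∫ ξ, charFun μ (t • ξ) * w ξ ∂κ)
      (α * ∫ ξ, charFun μ ξ * (jumpExponent ν ξ * w ξ) ∂κ) 1 := by
  have hs : Set.Ioo (1 / 2 : ℝ) 2 ∈ nhds (1 : ℝ) := Ioo_mem_nhds (by norm_num) (by norm_num)
  have hpos : ∀ t ∈ Set.Ioo (1 / 2 : ℝ) 2, 0 < t := fun t ht => one_half_pos.trans ht.1
  have hexp : ∀ t : ℝ, 0 < t → ∀ ξ,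
      charFun μ (t • ξ) = Complex.exp ((t ^ α : ℝ) * jumpExponent ν ξ) := fun t ht ξ => by
    rw [hμ, jumpExponent_smul hscale ht]
  have hmeas : ∀ t : ℝ, AEStronglyMeasurable (fun ξ => charFun μ (t • ξ) * w ξ) κ := fun t =>
    (stronglyMeasurable_charFun.comp_measurable
      (measurable_const_smul t)).aestronglyMeasurable.mul hw.aestronglyMeasurable
  set M := ∫ u, min 1 ‖u‖ ∂ν with hM
  have hM0 : 0 ≤ M := integral_nonneg fun u => by positivity
  have key := hasDerivAt_integral_of_dominated_loc_of_deriv_le (μ := κ) (x₀ := (1 : ℝ)) hs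
    (F := fun t ξ => charFun μ (t • ξ) * w ξ)
    (F' := fun t ξ => ((α * t ^ (α - 1) : ℝ) : ℂ) *
      (charFun μ (t • ξ) * (jumpExponent ν ξ * w ξ)))
    -- The outer `2` bounds `α * t ^ (α - 1)` on `(1/2, 2)`; the factor `2 * M * (1 + ‖ξ‖)` bounds
    -- the jump exponent.
    (bound := fun ξ => (2 * (2 * M)) * (1 + ‖ξ‖) * ‖w ξ‖)
    (Filter.Eventually.of_forall hmeas) ?_ ?_ (Filter.Eventually.of_forall fun ξ t ht => ?_)
    (integrable_mul_of_norm_le hw hw1 _) (Filter.Eventually.of_forall fun ξ t ht => ?_)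
  · have := key.2
    simp only [one_smul, Real.one_rpow, mul_one] at this
    rwa [integral_const_mul] at this
  · refine hw.norm.mono' (hmeas 1) (Filter.Eventually.of_forall fun ξ => ?_)
    rw [norm_mul]
    exact mul_le_of_le_one_left (norm_nonneg _) (norm_charFun_le_one _)
  · simp only [one_smul]
    exact (stronglyMeasurable_charFun.aestronglyMeasurable.mul
      ((continuous_jumpExponent hint).aestronglyMeasurable.mul hw.aestronglyMeasurable)).const_mul _
  · have ht0 := hpos t ht
    have h1 : α * t ^ (α - 1) ≤ 2 := by
      have : t ^ (α - 1) ≤ 2 := by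
        calc t ^ (α - 1) ≤ (1 / 2 : ℝ) ^ (α - 1) :=
              Real.rpow_le_rpow_of_nonpos (by norm_num) ht.1.le (by linarith)
          _ ≤ (1 / 2 : ℝ) ^ (-1 : ℝ) :=
              Real.rpow_le_rpow_of_exponent_ge (by norm_num) (by norm_num) (by linarith)
          _ = 2 := by rw [Real.rpow_neg_one]; norm_num
      nlinarith [Real.rpow_nonneg ht0.le (α - 1)]
    have h2 := norm_jumpExponent_le hint ξ
    have h3 : ‖charFun μ (t • ξ)‖ ≤ 1 := norm_charFun_le_one _
    rw [norm_mul, norm_mul, norm_mul, Complex.norm_real, Real.norm_of_nonneg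
      (mul_nonneg hα.le (Real.rpow_nonneg ht0.le _))]
    calc _ ≤ 2 * (1 * (2 * (1 + ‖ξ‖) * M * ‖w ξ‖)) := by gcongr
      _ = _ := by ring
  · have ht0 := hpos t ht
    have hd : HasDerivAt (fun s : ℝ => Complex.exp ((s ^ α : ℝ) * jumpExponent ν ξ) * w ξ)
        (Complex.exp ((t ^ α : ℝ) * jumpExponent ν ξ) *
          (((α * t ^ (α - 1) : ℝ) : ℂ) * jumpExponent ν ξ) * w ξ) t :=
      ((((Real.hasDerivAt_rpow_const (Or.inl ht0.ne')).ofReal_comp).mul_const _).cexp).mul_const _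
    have heq : (fun s : ℝ => charFun μ (s • ξ) * w ξ) =ᶠ[nhds t]
        fun s : ℝ => Complex.exp ((s ^ α : ℝ) * jumpExponent ν ξ) * w ξ := by
      filter_upwards [lt_mem_nhds ht0] with s hs
      rw [hexp s hs]
    refine (hd.congr_of_eventuallyEq heq).congr_deriv ?_
    rw [hexp t ht0]
    ring

end FourierRepresentation

/-! ### From the characteristic function to the identity -/

section SchwartzDerivative

variable {d : ℕ} {ν μ : Measure (EuclideanSpace ℝ (Fin d))} {α : ℝ}

theorem hasDerivAt_comp_smul {F : Type*} [NormedAddCommGroup F] [NormedSpace ℝ F]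
    {g : EuclideanSpace ℝ (Fin d) → F} (hg : Differentiable ℝ g) (y : EuclideanSpace ℝ (Fin d))
    (t : ℝ) : HasDerivAt (fun t : ℝ => g (t • y)) (fderiv ℝ g (t • y) y) t := by
  have h : HasDerivAt (fun t : ℝ => t • y) y t := by
    simpa using (hasDerivAt_id t).smul_const y
  exact (hg (t • y)).hasFDerivAt.comp_hasDerivAt t h

/-- Writing `Dg(sy) y = s⁻¹ Dg(sy)(sy)` bounds the derivative by `L / s` uniformly in `y`, so `μ`
needs no moments; staying above `t / 2` controls `s⁻¹`. -/
theorem hasDerivAt_integral_comp_smul {F : Type*} [NormedAddCommGroup F] [NormedSpace ℝ F]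
    [IsFiniteMeasure μ] {g : EuclideanSpace ℝ (Fin d) → F} (hg : ContDiff ℝ 1 g) {C L : ℝ}
    (hC : ∀ x, ‖g x‖ ≤ C) (hL : ∀ x, ‖fderiv ℝ g x x‖ ≤ L) {t : ℝ} (ht : 0 < t) :
    HasDerivAt (fun t : ℝ => ∫ y, g (t • y) ∂μ) (∫ y, fderiv ℝ g (t • y) y ∂μ) t := by
  have hs : Set.Ioi (t / 2) ∈ nhds t := Ioi_mem_nhds (by linarith)
  have hcont := hg.continuous
  have hcd := hg.continuous_fderiv one_ne_zero
  refine (hasDerivAt_integral_of_dominated_loc_of_deriv_le (μ := μ) hs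
    (F := fun t y => g (t • y)) (F' := fun t y => fderiv ℝ g (t • y) y)
    (bound := fun _ => (t / 2)⁻¹ * L)
    (Filter.Eventually.of_forall fun s => Continuous.aestronglyMeasurable (by fun_prop)) ?_
    (Continuous.aestronglyMeasurable (by fun_prop))
    (Filter.Eventually.of_forall fun y s hs => ?_) (integrable_const _)
    (Filter.Eventually.of_forall fun y s _ =>
      hasDerivAt_comp_smul (hg.differentiable one_ne_zero) y s)).2
  · exact .of_bound (Continuous.aestronglyMeasurable (by fun_prop)) C
      (Filter.Eventually.of_forall fun y => hC _)
  · have hs0 : 0 < s := (half_pos ht).trans hs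
    have h1 : fderiv ℝ g (s • y) y = s⁻¹ • fderiv ℝ g (s • y) (s • y) := by
      rw [map_smul, smul_smul, inv_mul_cancel₀ hs0.ne', one_smul]
    have hL0 : 0 ≤ L := (norm_nonneg _).trans (hL 0)
    rw [h1, norm_smul, norm_inv, Real.norm_of_nonneg hs0.le]
    have h2 : s⁻¹ ≤ (t / 2)⁻¹ := inv_anti₀ (half_pos ht) (le_of_lt hs)
    exact mul_le_mul h2 (hL _) (norm_nonneg _) (inv_nonneg.2 (half_pos ht).le)

/-- Fourier inversion, with `κ` the image of Lebesgue measure under `2π` so that the kernel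
`e^{2πi⟨x,ξ⟩}` takes the normalization of `charFun`. -/
theorem exists_fourier_representation (g : 𝓢(EuclideanSpace ℝ (Fin d), ℂ)) :
    ∃ (κ : Measure (EuclideanSpace ℝ (Fin d))) (w : EuclideanSpace ℝ (Fin d) → ℂ),
      SFinite κ ∧ Integrable w κ ∧ Integrable (fun ξ => ‖ξ‖ * ‖w ξ‖) κ ∧
      ∀ x, g x = ∫ ξ, Complex.exp ((inner ℝ x ξ : ℝ) * Complex.I) * w ξ ∂κ := by
  have hpi : (2 * Real.pi) ≠ 0 := Real.two_pi_pos.ne'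
  have hemb : MeasurableEmbedding fun u : EuclideanSpace ℝ (Fin d) => (2 * Real.pi) • u :=
    (Homeomorph.smulOfNeZero _ hpi).measurableEmbedding
  set h : 𝓢(EuclideanSpace ℝ (Fin d), ℂ) := FourierTransform.fourier g with hh
  refine ⟨volume.map fun u => (2 * Real.pi) • u, fun ξ => h ((2 * Real.pi)⁻¹ • ξ),
    inferInstance, ?_, ?_, fun x => ?_⟩
  · rw [hemb.integrable_map_iff]
    simpa only [Function.comp_def, smul_smul, inv_mul_cancel₀ hpi, one_smul] using
      h.integrable (μ := volume)
  · rw [hemb.integrable_map_iff]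
    have := (h.integrable_pow_mul (μ := volume) 1).const_mul (2 * Real.pi)
    refine this.congr (Filter.Eventually.of_forall fun ξ => ?_)
    simp only [Function.comp_def, smul_smul, inv_mul_cancel₀ hpi, one_smul, norm_smul, pow_one,
      Real.norm_of_nonneg Real.two_pi_pos.le, mul_assoc]
  · have hinv : FourierTransformInv.fourierInv h = g := by
      rw [hh]; simp
    conv_lhs => rw [← hinv, SchwartzMap.fourierInv_coe, Real.fourierInv_eq']
    rw [hemb.integral_map]
    refine integral_congr_ae (Filter.Eventually.of_forall fun ξ => ?_)
    simp only [smul_smul, inv_mul_cancel₀ hpi, one_smul, real_inner_smul_right,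
      real_inner_comm x ξ, smul_eq_mul]

/-- The two sides are the derivative at `t = 1` of the same function `t ↦ ∫ g(ty) μ(dy)`, computed
in space and in frequency. -/
theorem integral_fderiv_self_eq_of_charFun [SFinite ν] [IsProbabilityMeasure μ]
    (hα : 0 < α) (hα1 : α < 1) (hint : Integrable (fun u => min 1 ‖u‖) ν)
    (hscale : ∀ c : ℝ, 0 < c → ν = ENNReal.ofReal (c ^ (-α)) • dilate c ν)
    (hμ : ∀ ξ, charFun μ ξ = Complex.exp (jumpExponent ν ξ))
    (f : 𝓢(EuclideanSpace ℝ (Fin d), ℝ)) :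
    ∫ y, fderiv ℝ f y y ∂μ = α * ∫ y, ∫ u, (f (y + u) - f y) ∂ν ∂μ := by
  set g : 𝓢(EuclideanSpace ℝ (Fin d), ℂ) := f.postcompCLM Complex.ofRealCLM with hg
  have hgf : ∀ x, g x = (f x : ℂ) := fun x => rfl
  have hfd : ∀ x v, fderiv ℝ g x v = (fderiv ℝ f x v : ℂ) := fun x v => by
    have h : HasFDerivAt (fun x => (f x : ℂ)) (Complex.ofRealCLM.comp (fderiv ℝ f x)) x :=
      Complex.ofRealCLM.hasFDerivAt.comp x f.differentiableAt.hasFDerivAt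
    have : fderiv ℝ g x = Complex.ofRealCLM.comp (fderiv ℝ f x) := h.fderiv
    rw [this]; rfl
  obtain ⟨κ, w, hκ, hw, hw1, hrep⟩ := exists_fourier_representation g
  obtain ⟨C, L, -, -, hC, -, -, hL⟩ := exists_schwartz_bounds g
  have h1 := hasDerivAt_integral_comp_smul (μ := μ) (g.smooth 1) hC hL one_pos
  have h2 := hasDerivAt_integral_exp_jumpExponent (κ := κ) hα hα1 hint hscale hμ hw hw1
  have h3 : (fun t : ℝ => ∫ y, g (t • y) ∂μ) = fun t : ℝ => ∫ ξ, charFun μ (t • ξ) * w ξ ∂κ := by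
    funext t
    simp only [hrep]
    exact integral_integral_exp_inner_mul hw t
  rw [h3] at h1
  have h4 := h1.unique h2
  rw [← integral_integral_increment_eq hint hw hw1 hrep] at h4
  simp only [one_smul, hfd, hgf, ← Complex.ofReal_sub, integral_complex_ofReal] at h4
  exact_mod_cast h4

end SchwartzDerivative

/-! ### Two facts on ordinary differential equations -/

/-- The limit is taken in the integrated form `G s = G 1 + ∫ p` over `1..s`, and then
differentiated. The base point is `1` because the bound may blow up at `0`, as `t^(α-1)` does. -/
theorem hasDerivAt_of_tendsto_of_dominated {G p : ℝ → ℂ} {Gs ps : ℕ → ℝ → ℂ} {bound : ℝ → ℝ}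
    (hderiv : ∀ n, ∀ t, 0 < t → HasDerivAt (Gs n) (ps n t) t)
    (hcont : ∀ n, ContinuousOn (ps n) (Set.Ioi 0)) (hp : ContinuousOn p (Set.Ioi 0))
    (hbc : ContinuousOn bound (Set.Ioi 0)) (hbound : ∀ n t, 0 < t → ‖ps n t‖ ≤ bound t)
    (hG : ∀ t, 0 < t → Filter.Tendsto (fun n => Gs n t) Filter.atTop (nhds (G t)))
    (hps : ∀ t, 0 < t → Filter.Tendsto (fun n => ps n t) Filter.atTop (nhds (p t)))
    {t : ℝ} (ht : 0 < t) : HasDerivAt G (p t) t := by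
  have hsub : ∀ s : ℝ, 0 < s → Set.uIcc 1 s ⊆ Set.Ioi (0 : ℝ) := fun s hs x hx =>
    (lt_min one_pos hs).trans_le hx.1
  have hint : ∀ s : ℝ, 0 < s → G s = G 1 + ∫ r in (1 : ℝ)..s, p r := fun s hs => by
    have hn : ∀ n, ∫ r in (1 : ℝ)..s, ps n r = Gs n s - Gs n 1 := fun n =>
      intervalIntegral.integral_eq_sub_of_hasDerivAt (fun r hr => hderiv n r (hsub s hs hr))
        ((hcont n).mono (hsub s hs)).intervalIntegrable
    have hlim : Filter.Tendsto (fun n => ∫ r in (1 : ℝ)..s, ps n r) Filter.atTop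
        (nhds (∫ r in (1 : ℝ)..s, p r)) := by
      refine intervalIntegral.tendsto_integral_filter_of_dominated_convergence bound
        (Filter.Eventually.of_forall fun n => ?_) (Filter.Eventually.of_forall fun n => ?_)
        (hbc.mono (hsub s hs)).intervalIntegrable ?_
      · exact ((hcont n).mono (Set.uIoc_subset_uIcc.trans (hsub s hs))).aestronglyMeasurable
          measurableSet_uIoc
      · exact Filter.Eventually.of_forall fun r hr =>
          hbound n r (hsub s hs (Set.uIoc_subset_uIcc hr))
      · exact Filter.Eventually.of_forall fun r hr => hps r (hsub s hs (Set.uIoc_subset_uIcc hr))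
    simp only [hn] at hlim
    have := tendsto_nhds_unique hlim ((hG s hs).sub (hG 1 one_pos))
    rw [this]; ring
  have h1 : HasDerivAt (fun s => G 1 + ∫ r in (1 : ℝ)..s, p r) (p t) t := by
    refine (intervalIntegral.integral_hasDerivAt_right
      (hp.mono (hsub t ht)).intervalIntegrable ?_ (hp.continuousAt (Ioi_mem_nhds ht))).const_add _
    exact hp.stronglyMeasurableAtFilter isOpen_Ioi t ht
  refine h1.congr_of_eventuallyEq ?_
  filter_upwards [lt_mem_nhds ht] with s hs using hint s hs

/-- The initial value problem `G' = α t^{α-1} c G` on `(0,∞)` with `G(0) = 1`. -/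
theorem eq_exp_of_hasDerivAt {G : ℝ → ℂ} {α : ℝ} (hα : 0 < α) {c : ℂ} (h0 : G 0 = 1)
    (hG0 : ContinuousAt G 0)
    (hderiv : ∀ t, 0 < t → HasDerivAt G (((α * t ^ (α - 1) : ℝ) : ℂ) * (c * G t)) t) :
    G 1 = Complex.exp c := by
  -- Integrating factor: `H` is constant on `(0, ∞)`, and since `t^α → 0` at `0` its value is the
  -- limit `G 0 = 1`.
  set H : ℝ → ℂ := fun t => G t * Complex.exp (-((t ^ α : ℝ) * c)) with hH
  have hHd : ∀ t ∈ Set.Ioi (0 : ℝ), HasDerivAt H 0 t := fun t ht => by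
    have h1 : HasDerivAt (fun t : ℝ => Complex.exp (-((t ^ α : ℝ) * c)))
        (Complex.exp (-((t ^ α : ℝ) * c)) * (-(((α * t ^ (α - 1) : ℝ) : ℂ) * c))) t :=
      ((((Real.hasDerivAt_rpow_const (Or.inl (ne_of_gt ht))).ofReal_comp).mul_const _).neg).cexp
    refine ((hderiv t ht).mul h1).congr_deriv ?_
    ring
  have hconst : ∀ t ∈ Set.Ioi (0 : ℝ), H t = H 1 := fun t ht =>
    isOpen_Ioi.is_const_of_deriv_eq_zero isPreconnected_Ioi
      (fun s hs => (hHd s hs).differentiableAt.differentiableWithinAt)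
      (fun s hs => (hHd s hs).deriv) ht (Set.mem_Ioi.2 one_pos)
  have hH0 : ContinuousAt H 0 := by
    refine hG0.mul (Complex.continuous_exp.continuousAt.comp ?_)
    exact ((Complex.continuous_ofReal.continuousAt.comp
      (Real.continuousAt_rpow_const 0 α (Or.inr hα.le))).mul_const c).neg
  have hlim : Filter.Tendsto H (nhdsWithin 0 (Set.Ioi 0)) (nhds (H 1)) :=
    tendsto_const_nhds.congr' (by
      filter_upwards [self_mem_nhdsWithin] with t ht using (hconst t ht).symm)
  have h := tendsto_nhds_unique hlim (hH0.tendsto.mono_left nhdsWithin_le_nhds)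
  simp only [hH, Real.one_rpow, Real.zero_rpow hα.ne', h0, Complex.ofReal_one, one_mul,
    Complex.ofReal_zero, zero_mul, neg_zero, Complex.exp_zero] at h
  rw [Complex.exp_neg] at h
  field_simp at h
  exact h

/-! ### From the identity to the characteristic function -/

section SteinIdentity

variable {d : ℕ} {ν μ : Measure (EuclideanSpace ℝ (Fin d))} {α : ℝ}

/-- Both sides are linear in the test function, so real and imaginary parts can be treated
separately. Complex test functions are needed to approximate characters. -/
theorem integral_fderiv_self_eq_complex [IsFiniteMeasure μ]
    (hint : Integrable (fun u => min 1 ‖u‖) ν)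
    (H : ∀ f : 𝓢(EuclideanSpace ℝ (Fin d), ℝ),
      ∫ y, fderiv ℝ f y y ∂μ = α * ∫ y, ∫ u, (f (y + u) - f y) ∂ν ∂μ)
    (g : 𝓢(EuclideanSpace ℝ (Fin d), ℂ)) :
    ∫ y, fderiv ℝ g y y ∂μ = α * ∫ y, ∫ u, (g (y + u) - g y) ∂ν ∂μ := by
  obtain ⟨h1, -, h3, h4⟩ := integrable_terms hint μ g 0
  have key : ∀ ℓ : ℂ →L[ℝ] ℝ, ℓ (∫ y, fderiv ℝ g y y ∂μ) =
      ℓ (α * ∫ y, ∫ u, (g (y + u) - g y) ∂ν ∂μ) := fun ℓ => by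
    have hfd : ∀ x v, fderiv ℝ (g.postcompCLM ℓ) x v = ℓ (fderiv ℝ g x v) := fun x v => by
      have h : HasFDerivAt (g.postcompCLM ℓ) (ℓ.comp (fderiv ℝ g x)) x :=
        ℓ.hasFDerivAt.comp x g.differentiableAt.hasFDerivAt
      rw [h.fderiv]; rfl
    have := H (g.postcompCLM ℓ)
    simp only [hfd, SchwartzMap.postcompCLM_apply, ← map_sub] at this
    rw [← Complex.real_smul, map_smul, smul_eq_mul, ← ℓ.integral_comp_comm h1,
      ← ℓ.integral_comp_comm h4, this]
    simp only [ℓ.integral_comp_comm (h3 _)]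
  exact Complex.ext (key Complex.reCLM) (key Complex.imCLM)

/-- The identity is applied to `g(r ·)`: the left side gains a factor `r`, and the substitution `u ↦
r u` in `ν` gives `r^α` on the right. Their quotient is `r^(α-1)`. -/
theorem hasDerivAt_integral_comp_smul_of_stein [IsFiniteMeasure μ]
    (hint : Integrable (fun u => min 1 ‖u‖) ν)
    (hscale : ∀ c : ℝ, 0 < c → ν = ENNReal.ofReal (c ^ (-α)) • dilate c ν)
    (H : ∀ f : 𝓢(EuclideanSpace ℝ (Fin d), ℝ),
      ∫ y, fderiv ℝ f y y ∂μ = α * ∫ y, ∫ u, (f (y + u) - f y) ∂ν ∂μ)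
    (g : 𝓢(EuclideanSpace ℝ (Fin d), ℂ)) {r : ℝ} (hr : 0 < r) :
    HasDerivAt (fun t : ℝ => ∫ y, g (t • y) ∂μ)
      (((α * r ^ (α - 1) : ℝ) : ℂ) * ∫ y, ∫ u, (g (r • y + u) - g (r • y)) ∂ν ∂μ) r := by
  obtain ⟨C, L, -, -, hC, -, -, hL⟩ := exists_schwartz_bounds g
  refine (hasDerivAt_integral_comp_smul (μ := μ) (g.smooth 1) hC hL hr).congr_deriv ?_
  set gr := SchwartzMap.compCLMOfContinuousLinearEquiv ℝ
    (ContinuousLinearEquiv.smulLeft (R₁ := ℝ) (M₁ := EuclideanSpace ℝ (Fin d))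
      (Units.mk0 r hr.ne')) g with hgr
  have hgr_apply : ∀ y, gr y = g (r • y) := fun y => rfl
  have hfd : ∀ y, fderiv ℝ gr y y = r * fderiv ℝ g (r • y) y := fun y => by
    have h : HasFDerivAt gr ((fderiv ℝ g (r • y)).comp
        (r • ContinuousLinearMap.id ℝ (EuclideanSpace ℝ (Fin d)))) y :=
      (g.differentiableAt (x := r • y)).hasFDerivAt.comp (f := fun y => r • y) y
        ((hasFDerivAt_id y).const_smul r)
    rw [h.fderiv]
    simp
  have h := integral_fderiv_self_eq_complex hint H gr
  have hinner : ∀ y, ∫ u, (gr (y + u) - gr y) ∂ν =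
      (r ^ α : ℝ) * ∫ u, (g (r • y + u) - g (r • y)) ∂ν := fun y => by
    simp only [hgr_apply, smul_add]
    rw [integral_comp_smul_of_scale hscale hr (fun u => g (r • y + u) - g (r • y)),
      Complex.real_smul]
  simp only [hfd, hinner] at h
  rw [integral_const_mul, integral_const_mul] at h
  have hr' : (r : ℂ) ≠ 0 := Complex.ofReal_ne_zero.2 hr.ne'
  rw [Real.rpow_sub_one hr.ne']
  apply mul_left_cancel₀ hr'
  rw [h]
  push_cast
  field_simp

/-- A smooth cutoff of `y ↦ e^{i⟨y,ξ⟩}`, equal to it for `‖y‖ ≤ n + 1`. -/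
noncomputable def truncatedExp (ξ : EuclideanSpace ℝ (Fin d)) (n : ℕ)
    (y : EuclideanSpace ℝ (Fin d)) : ℂ :=
  ((⟨1, 2, one_pos, one_lt_two⟩ : ContDiffBump (0 : EuclideanSpace ℝ (Fin d)))
    (((n : ℝ) + 1)⁻¹ • y) : ℝ) * Complex.exp ((inner ℝ y ξ : ℝ) * Complex.I)

theorem contDiff_truncatedExp (ξ : EuclideanSpace ℝ (Fin d)) (n : ℕ) :
    ContDiff ℝ (⊤ : ℕ∞) (truncatedExp ξ n) := by
  refine ContDiff.mul ?_ ?_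
  · exact Complex.ofRealCLM.contDiff.comp ((ContDiffBump.contDiff _).comp (by fun_prop))
  · exact ((Complex.ofRealCLM.contDiff.comp (contDiff_id.inner ℝ contDiff_const)).mul contDiff_const).cexp

theorem hasCompactSupport_truncatedExp (ξ : EuclideanSpace ℝ (Fin d)) (n : ℕ) :
    HasCompactSupport (truncatedExp ξ n) := by
  have hn : ((n : ℝ) + 1)⁻¹ ≠ 0 := by positivity
  refine HasCompactSupport.mul_right ?_
  have h := (ContDiffBump.hasCompactSupport
    (⟨1, 2, one_pos, one_lt_two⟩ : ContDiffBump (0 : EuclideanSpace ℝ (Fin d)))).comp_homeomorph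
      (Homeomorph.smulOfNeZero _ hn)
  exact h.comp_left (g := ((↑) : ℝ → ℂ)) Complex.ofReal_zero

theorem norm_truncatedExp_le_one (ξ : EuclideanSpace ℝ (Fin d)) (n : ℕ)
    (y : EuclideanSpace ℝ (Fin d)) : ‖truncatedExp ξ n y‖ ≤ 1 := by
  rw [truncatedExp, norm_mul, Complex.norm_exp_ofReal_mul_I, mul_one, Complex.norm_real,
    Real.norm_of_nonneg (ContDiffBump.nonneg _)]
  exact ContDiffBump.le_one _

theorem tendsto_truncatedExp (ξ y : EuclideanSpace ℝ (Fin d)) :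
    Filter.Tendsto (fun n => truncatedExp ξ n y) Filter.atTop
      (nhds (Complex.exp ((inner ℝ y ξ : ℝ) * Complex.I))) := by
  refine tendsto_const_nhds.congr' ?_
  filter_upwards [Filter.eventually_ge_atTop ⌈‖y‖⌉₊] with n hn
  have h1 : ‖y‖ ≤ (n : ℝ) + 1 := (Nat.ceil_le.1 hn).trans (by linarith)
  rw [truncatedExp, ContDiffBump.one_of_mem_closedBall, Complex.ofReal_one, one_mul]
  rw [mem_closedBall_zero_iff, norm_smul, norm_inv, Real.norm_of_nonneg (by positivity)]
  exact inv_mul_le_one_of_le₀ h1 (by positivity)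

/-- Uniformity in `n` is the point: stretching the cutoff by `n + 1 ≥ 1` only lowers its Lipschitz
constant. Increments then have a common majorant, a multiple of `min 1 ‖u‖`. -/
theorem exists_lipschitz_truncatedExp (ξ : EuclideanSpace ℝ (Fin d)) :
    ∃ L : ℝ, 0 ≤ L ∧ ∀ n x y, ‖truncatedExp ξ n x - truncatedExp ξ n y‖ ≤ L * ‖x - y‖ := by
  set χ : ContDiffBump (0 : EuclideanSpace ℝ (Fin d)) := ⟨1, 2, one_pos, one_lt_two⟩ with hχ
  obtain ⟨K, hK⟩ := ContDiff.lipschitzWith_of_hasCompactSupport χ.hasCompactSupport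
    (χ.contDiff (n := 1)) one_ne_zero
  refine ⟨K + ‖ξ‖, by positivity, fun n x y => ?_⟩
  have hn : ((n : ℝ) + 1)⁻¹ ≤ 1 := inv_le_one_of_one_le₀ (by linarith [n.cast_nonneg (α := ℝ)])
  have h1 : ‖χ (((n : ℝ) + 1)⁻¹ • x) - χ (((n : ℝ) + 1)⁻¹ • y)‖ ≤ K * ‖x - y‖ := by
    refine (hK.norm_sub_le _ _).trans ?_
    rw [← smul_sub, norm_smul, norm_inv, Real.norm_of_nonneg (by positivity)]
    exact mul_le_mul_of_nonneg_left (mul_le_of_le_one_left (norm_nonneg _) hn) K.2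
  have h2 : ‖Complex.exp ((inner ℝ x ξ : ℝ) * Complex.I) -
      Complex.exp ((inner ℝ y ξ : ℝ) * Complex.I)‖ ≤ ‖ξ‖ * ‖x - y‖ := by
    have hx : Complex.exp ((inner ℝ x ξ : ℝ) * Complex.I) -
        Complex.exp ((inner ℝ y ξ : ℝ) * Complex.I) =
        Complex.exp ((inner ℝ y ξ : ℝ) * Complex.I) *
          (Complex.exp (Complex.I * (inner ℝ (x - y) ξ : ℝ)) - 1) := by
      rw [mul_sub, ← Complex.exp_add, inner_sub_left, Complex.ofReal_sub]
      ring_nf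
    rw [hx, norm_mul, Complex.norm_exp_ofReal_mul_I, one_mul]
    refine Real.norm_exp_I_mul_ofReal_sub_one_le.trans ((norm_inner_le_norm _ _).trans_eq ?_)
    rw [mul_comm]
  have hsplit : truncatedExp ξ n x - truncatedExp ξ n y =
      ((χ (((n : ℝ) + 1)⁻¹ • x) - χ (((n : ℝ) + 1)⁻¹ • y) : ℝ) : ℂ) *
        Complex.exp ((inner ℝ x ξ : ℝ) * Complex.I) +
      (χ (((n : ℝ) + 1)⁻¹ • y) : ℝ) * (Complex.exp ((inner ℝ x ξ : ℝ) * Complex.I) -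
        Complex.exp ((inner ℝ y ξ : ℝ) * Complex.I)) := by
    simp only [truncatedExp, ← hχ]
    push_cast
    ring
  rw [hsplit, add_mul]
  refine (norm_add_le _ _).trans (add_le_add ?_ ?_)
  · rw [norm_mul, Complex.norm_exp_ofReal_mul_I, mul_one, Complex.norm_real]
    exact h1
  · rw [norm_mul, Complex.norm_real, Real.norm_of_nonneg χ.nonneg]
    exact (mul_le_of_le_one_left (norm_nonneg _) χ.le_one).trans h2

/-- The limit is the jump operator applied to a character, which is an eigenfunction with eigenvalue
`jumpExponent ν ξ`. -/
theorem tendsto_integral_increment_truncatedExp (hint : Integrable (fun u => min 1 ‖u‖) ν)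
    (ξ x : EuclideanSpace ℝ (Fin d)) :
    Filter.Tendsto (fun n => ∫ u, (truncatedExp ξ n (x + u) - truncatedExp ξ n x) ∂ν)
      Filter.atTop
      (nhds (jumpExponent ν ξ * Complex.exp ((inner ℝ x ξ : ℝ) * Complex.I))) := by
  obtain ⟨L, hL0, hL⟩ := exists_lipschitz_truncatedExp ξ
  have hlim : ∫ u, (Complex.exp ((inner ℝ (x + u) ξ : ℝ) * Complex.I) -
      Complex.exp ((inner ℝ x ξ : ℝ) * Complex.I)) ∂ν =
      jumpExponent ν ξ * Complex.exp ((inner ℝ x ξ : ℝ) * Complex.I) := by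
    rw [jumpExponent, ← integral_mul_const]
    refine integral_congr_ae (Filter.Eventually.of_forall fun u => ?_)
    simp only [inner_add_left, real_inner_comm u ξ, Complex.ofReal_add, add_mul, Complex.exp_add,
      mul_comm Complex.I]
    ring
  rw [← hlim]
  refine tendsto_integral_of_dominated_convergence (fun u => (2 * 1 + L) * min 1 ‖u‖)
    (fun n => ?_) (hint.const_mul _) (fun n => Filter.Eventually.of_forall fun u =>
      norm_increment_le (norm_truncatedExp_le_one ξ n) hL0 (hL n) x u)
    (Filter.Eventually.of_forall fun u =>
      (tendsto_truncatedExp ξ (x + u)).sub (tendsto_truncatedExp ξ x))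
  have := (contDiff_truncatedExp ξ n).continuous
  exact Continuous.aestronglyMeasurable (by fun_prop)

theorem charFun_eq_exp_jumpExponent_of_stein [IsProbabilityMeasure μ] (hα : 0 < α)
    (hint : Integrable (fun u => min 1 ‖u‖) ν)
    (hscale : ∀ c : ℝ, 0 < c → ν = ENNReal.ofReal (c ^ (-α)) • dilate c ν)
    (H : ∀ f : 𝓢(EuclideanSpace ℝ (Fin d), ℝ),
      ∫ y, fderiv ℝ f y y ∂μ = α * ∫ y, ∫ u, (f (y + u) - f y) ∂ν ∂μ)
    (ξ : EuclideanSpace ℝ (Fin d)) :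
    charFun μ ξ = Complex.exp (jumpExponent ν ξ) := by
  obtain ⟨L, hL0, hL⟩ := exists_lipschitz_truncatedExp ξ
  have hcont : ∀ n, Continuous (truncatedExp ξ n) := fun n => (contDiff_truncatedExp ξ n).continuous
  have hDcont : ∀ n, Continuous
      fun x => ∫ u, (truncatedExp ξ n (x + u) - truncatedExp ξ n x) ∂ν := fun n =>
    continuous_integral_increment hint (hcont n) (norm_truncatedExp_le_one ξ n) hL0 (hL n)
  set B := (2 * 1 + L) * ∫ u, min 1 ‖u‖ ∂ν with hB
  have hDbound : ∀ n x, ‖∫ u, (truncatedExp ξ n (x + u) - truncatedExp ξ n x) ∂ν‖ ≤ B :=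
    fun n x => norm_integral_increment_le hint (norm_truncatedExp_le_one ξ n) hL0 (hL n) x
  have hG : ∀ t : ℝ, charFun μ (t • ξ) =
      ∫ y, Complex.exp ((inner ℝ (t • y) ξ : ℝ) * Complex.I) ∂μ := fun t => by
    simp only [charFun_apply, real_inner_smul_left, real_inner_smul_right]
  have hφcont : Continuous fun t : ℝ => charFun μ (t • ξ) := by
    simp only [hG]
    refine continuous_of_dominated (bound := fun _ => 1)
      (fun t => Continuous.aestronglyMeasurable (by fun_prop))
      (fun t => Filter.Eventually.of_forall fun y => ?_) (integrable_const _)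
      (Filter.Eventually.of_forall fun y => by fun_prop)
    rw [Complex.norm_exp_ofReal_mul_I]
  have hpow : ContinuousOn (fun t : ℝ => α * t ^ (α - 1)) (Set.Ioi 0) :=
    continuousOn_const.mul
      (continuousOn_id.rpow_const fun t ht => Or.inl (ne_of_gt (Set.mem_Ioi.1 ht)))
  have hpowC : ContinuousOn (fun t : ℝ => ((α * t ^ (α - 1) : ℝ) : ℂ)) (Set.Ioi 0) :=
    Complex.continuous_ofReal.comp_continuousOn hpow
  have key := eq_exp_of_hasDerivAt (G := fun t : ℝ => charFun μ (t • ξ)) hα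
    (c := jumpExponent ν ξ) (by simp) hφcont.continuousAt fun t ht => ?_
  · simpa using key
  -- Characters are not Schwartz, so the differential equation is first obtained for the compactly
  -- supported truncations and then passed to the limit.
  refine hasDerivAt_of_tendsto_of_dominated
    (p := fun t : ℝ => ((α * t ^ (α - 1) : ℝ) : ℂ) * (jumpExponent ν ξ * charFun μ (t • ξ)))
    (Gs := fun n t => ∫ y, truncatedExp ξ n (t • y) ∂μ)
    (ps := fun n t => ((α * t ^ (α - 1) : ℝ) : ℂ) *
      ∫ y, ∫ u, (truncatedExp ξ n (t • y + u) - truncatedExp ξ n (t • y)) ∂ν ∂μ)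
    (bound := fun t => α * t ^ (α - 1) * B)
    (fun n r hr => ?_) (fun n => ?_) ?_ (hpow.mul continuousOn_const) (fun n r hr => ?_)
    (fun r hr => ?_) (fun r hr => ?_) ht
  · exact hasDerivAt_integral_comp_smul_of_stein hint hscale H
      ((hasCompactSupport_truncatedExp ξ n).toSchwartzMap (contDiff_truncatedExp ξ n)) hr
  · refine hpowC.mul (Continuous.continuousOn ?_)
    exact continuous_of_dominated (bound := fun _ => B)
      (fun r => ((hDcont n).comp (continuous_const_smul r)).aestronglyMeasurable)
      (fun r => Filter.Eventually.of_forall fun y => hDbound n _) (integrable_const _)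
      (Filter.Eventually.of_forall fun y =>
        (hDcont n).comp (continuous_id.smul continuous_const))
  · exact hpowC.mul (continuous_const.mul hφcont).continuousOn
  · rw [norm_mul, Complex.norm_real,
      Real.norm_of_nonneg (mul_nonneg hα.le (Real.rpow_nonneg hr.le _))]
    refine mul_le_mul_of_nonneg_left ?_ (mul_nonneg hα.le (Real.rpow_nonneg hr.le _))
    simpa using norm_integral_le_of_norm_le_const (μ := μ)
      (Filter.Eventually.of_forall fun y => hDbound n (r • y))
  · rw [hG]
    refine tendsto_integral_of_dominated_convergence (fun _ => 1)
      (fun n => ((hcont n).comp (continuous_const_smul r)).aestronglyMeasurable)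
      (integrable_const _)
      (fun n => Filter.Eventually.of_forall fun y => norm_truncatedExp_le_one ξ n _)
      (Filter.Eventually.of_forall fun y => tendsto_truncatedExp ξ _)
  · refine Filter.Tendsto.const_mul _ ?_
    rw [hG, ← integral_const_mul]
    exact tendsto_integral_of_dominated_convergence (fun _ => B)
      (fun n => ((hDcont n).comp (continuous_const_smul r)).aestronglyMeasurable)
      (integrable_const _) (fun n => Filter.Eventually.of_forall fun y => hDbound n _)
      (Filter.Eventually.of_forall fun y => tendsto_integral_increment_truncatedExp hint ξ _)

end SteinIdentity

/-! ### Removing the drift -/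

section Characterization

variable {d : ℕ} {ν μ : Measure (EuclideanSpace ℝ (Fin d))} {α : ℝ}

/-- Under the law of `X - b₀`, the term `Df(Y) Y` splits into `Df(Y) X - Df(Y) b₀`, while increments
commute with translations. -/
theorem centered_stein_iff [IsFiniteMeasure μ] (hint : Integrable (fun u => min 1 ‖u‖) ν)
    (b₀ : EuclideanSpace ℝ (Fin d)) (f : 𝓢(EuclideanSpace ℝ (Fin d), ℝ)) :
    ∫ y, fderiv ℝ f y y ∂(μ.map (· + -b₀)) =
        α * ∫ y, ∫ u, (f (y + u) - f y) ∂ν ∂(μ.map (· + -b₀)) ↔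
      ∫ x, fderiv ℝ (SchwartzMap.compSubConstCLM ℝ b₀ f) x x ∂μ =
        ∫ x, fderiv ℝ (SchwartzMap.compSubConstCLM ℝ b₀ f) x b₀ ∂μ +
          α * ∫ x, ∫ u, (SchwartzMap.compSubConstCLM ℝ b₀ f (x + u) -
            SchwartzMap.compSubConstCLM ℝ b₀ f x) ∂ν ∂μ := by
  set f₁ := SchwartzMap.compSubConstCLM ℝ b₀ f with hf₁
  have hf₁_apply : ∀ x, f₁ x = f (x + -b₀) := fun x => by
    rw [hf₁, SchwartzMap.compSubConstCLM_apply, sub_eq_add_neg]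
  have hfd : ∀ x, fderiv ℝ f₁ x = fderiv ℝ f (x + -b₀) := fun x => by
    rw [← fderiv_comp_add_right]
    congr 1
  have hemb : MeasurableEmbedding fun x : EuclideanSpace ℝ (Fin d) => x + -b₀ :=
    (Homeomorph.addRight (-b₀)).measurableEmbedding
  obtain ⟨h1, h2, -, -⟩ := integrable_terms hint μ f₁ b₀
  have h3 : ∫ x, fderiv ℝ f (x + -b₀) (x + -b₀) ∂μ =
      ∫ x, fderiv ℝ f₁ x x ∂μ - ∫ x, fderiv ℝ f₁ x b₀ ∂μ := by
    rw [← integral_sub h1 h2]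
    simp only [hfd, map_add, map_neg, sub_eq_add_neg]
  rw [hemb.integral_map, hemb.integral_map, h3, sub_eq_iff_eq_add']
  simp only [hf₁_apply, add_right_comm]

theorem stein_iff_charFun_eq [SFinite ν] [IsProbabilityMeasure μ] (hα : 0 < α) (hα1 : α < 1)
    (hint : Integrable (fun u => min 1 ‖u‖) ν)
    (hscale : ∀ c : ℝ, 0 < c → ν = ENNReal.ofReal (c ^ (-α)) • dilate c ν)
    (b₀ : EuclideanSpace ℝ (Fin d)) :
    (∀ f : 𝓢(EuclideanSpace ℝ (Fin d), ℝ),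
      ∫ x, fderiv ℝ f x x ∂μ =
        ∫ x, fderiv ℝ f x b₀ ∂μ + α * ∫ x, ∫ u, (f (x + u) - f x) ∂ν ∂μ) ↔
    ∀ ξ, charFun μ ξ =
      Complex.exp (Complex.I * (inner ℝ b₀ ξ : ℝ) + jumpExponent ν ξ) := by
  have : IsProbabilityMeasure (μ.map (· + -b₀)) :=
    Measure.isProbabilityMeasure_map (by fun_prop)
  have hchar : ∀ ξ, (charFun (μ.map (· + -b₀)) ξ = Complex.exp (jumpExponent ν ξ) ↔
      charFun μ ξ = Complex.exp (Complex.I * (inner ℝ b₀ ξ : ℝ) + jumpExponent ν ξ)) := fun ξ => by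
    rw [charFun_map_add_const, inner_neg_left, Complex.ofReal_neg, neg_mul, Complex.exp_neg,
      mul_inv_eq_iff_eq_mul₀ (Complex.exp_ne_zero _), ← Complex.exp_add, mul_comm Complex.I,
      add_comm]
  simp only [← hchar]
  constructor
  · intro H ξ
    exact charFun_eq_exp_jumpExponent_of_stein hα hint hscale
      (fun f => (centered_stein_iff hint b₀ f).2 (H _)) ξ
  · intro H f
    -- Every Schwartz function is the `b₀`-translate of its own `-b₀`-translate.
    have h := (centered_stein_iff hint b₀ (SchwartzMap.compSubConstCLM ℝ (-b₀) f)).1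
      (integral_fderiv_self_eq_of_charFun hα hα1 hint hscale H _)
    simpa only [SchwartzMap.compSubConstCLM_comp, neg_add_cancel, add_neg_cancel,
      SchwartzMap.compSubConstCLM_zero, ContinuousLinearMap.id_apply] using h

end Characterization

end SteinStable

/-! ### The main theorem -/

theorem mainTheorem2 {d : ℕ} (hd : 1 ≤ d)
    {Ω : Type*} [MeasurableSpace Ω] (P : Measure Ω) [IsProbabilityMeasure P]
    (X : Ω → EuclideanSpace ℝ (Fin d)) (hX : AEMeasurable X P)
    (b : EuclideanSpace ℝ (Fin d)) (α : ℝ) (hα0 : 0 < α) (hα1 : α < 1)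
    (ν : Measure (EuclideanSpace ℝ (Fin d))) (hν : SteinStable.IsLevyMeasure ν)
    (hscale : ∀ c : ℝ, 0 < c → ν = ENNReal.ofReal (c ^ (-α)) • SteinStable.dilate c ν) :
    -- every integral in the characterization converges absolutely
    (IntegrableOn (fun u : EuclideanSpace ℝ (Fin d) => u) (Metric.closedBall 0 1) ν ∧
      ∀ f : 𝓢(EuclideanSpace ℝ (Fin d), ℝ),
        Integrable (fun ω => inner ℝ (X ω) (∇ f (X ω))) P ∧
        Integrable (fun ω => inner ℝ (SteinStable.drift b ν) (∇ f (X ω))) P ∧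
        (∀ x, Integrable (fun u => f (x + u) - f x) ν) ∧
        Integrable (fun ω => ∫ u, (f (X ω + u) - f (X ω)) ∂ν) P) ∧
    -- the characterization
    ((∀ f : 𝓢(EuclideanSpace ℝ (Fin d), ℝ),
        ∫ ω, inner ℝ (X ω) (∇ f (X ω)) ∂P =
          ∫ ω, inner ℝ (SteinStable.drift b ν) (∇ f (X ω)) ∂P
            + α * ∫ ω, (∫ u, (f (X ω + u) - f (X ω)) ∂ν) ∂P) ↔
      SteinStable.IsStableLaw (P.map X) b α ν) := by
  have hint := SteinStable.integrable_min_one_norm hd hν hα0 hα1 hscale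
  have := hν.sigmaFinite
  have hprob : IsProbabilityMeasure (P.map X) := Measure.isProbabilityMeasure_map hX
  simp only [SteinStable.inner_gradient_eq_fderiv]
  refine ⟨⟨SteinStable.integrableOn_id_closedBall hint, fun f => ?_⟩, ?_⟩
  · obtain ⟨h1, h2, h3, h4⟩ :=
      SteinStable.integrable_terms hint (P.map X) f (SteinStable.drift b ν)
    exact ⟨h1.comp_aemeasurable hX, h2.comp_aemeasurable hX, h3, h4.comp_aemeasurable hX⟩
  have hmap : ∀ f : 𝓢(EuclideanSpace ℝ (Fin d), ℝ),
      (∫ ω, fderiv ℝ f (X ω) (X ω) ∂P =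
          ∫ ω, fderiv ℝ f (X ω) (SteinStable.drift b ν) ∂P
            + α * ∫ ω, (∫ u, (f (X ω + u) - f (X ω)) ∂ν) ∂P) ↔
      (∫ x, fderiv ℝ f x x ∂(P.map X) =
          ∫ x, fderiv ℝ f x (SteinStable.drift b ν) ∂(P.map X)
            + α * ∫ x, (∫ u, (f (x + u) - f x) ∂ν) ∂(P.map X)) := fun f => by
    obtain ⟨h1, h2, -, h4⟩ :=
      SteinStable.integrable_terms hint (P.map X) f (SteinStable.drift b ν)
    rw [integral_map hX h1.aestronglyMeasurable, integral_map hX h2.aestronglyMeasurable,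
      integral_map hX h4.aestronglyMeasurable]
  simp only [hmap]
  rw [SteinStable.stein_iff_charFun_eq hα0 hα1 hint hscale]
  simp only [← SteinStable.levyExponent_zero_eq hint]
  -- The polar form follows from scaling alone, so the identity only has to supply the
  -- characteristic function.
  exact ⟨fun h => ⟨hα0, by linarith, ⟨hprob, .zero, hν, h⟩,
    SteinStable.exists_eq_polarStableMeasure hd hν hα0 hscale⟩, fun h => h.infDiv.charFun_eq⟩
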